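/- Conventions. A face is a unit square $[\mathbf x,i]^\star=\{\mathbf x+\lambda\mathbf e_j+\mu\mathbf e_k:\lambda,\mu\in[0,1]\}$ with $\mathbf x\in\mathbb Z^3$ and $\{i,j,k\}=\{1,2,3\}$; a pattern is a finite union of faces. For $\mathbf v\in\mathbb R^3_{>0}$, the discrete plane $\Gamma_{\mathbf v}$ is the union of the faces $[\mathbf x,i]^\star$ with $0\le\langle\mathbf x,\mathbf v\rangle<\langle\mathbf e_i,\mathbf v\rangle$. Let $U=[\mathbf 0,1]^\star\cup[\mathbf 0,2]^\star\cup[\mathbf 0,3]^\star$. For a substitution $\sigma$ on $\{1,2,3\}$ whose incidence matrix $\mathbf M_\sigma$ (with $i$th column $\mathbf P(\sigma(i))$, where $\mathbf P(w)\in\mathbb N^3$ counts the occurrences of the letters $1,2,3$ in $w$) has determinant $\pm1$, the dual substitution sends a face $[\mathbf x,i]^\star$ to the union of the faces $[\mathbf M_\sigma^{-1}(\mathbf x+\mathbf P(s)),j]^\star$ over all $j\in\{1,2,3\}$ and all words $p,s$ with $\sigma(j)=pis$, and a union of faces to the union of their images. For integers $a,b\ge0$ let $\Sigma_{a,b}$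 be the dual substitution of $1\mapsto3,\ 2\mapsto13^a,\ 3\mapsto23^b$. A sequence $(a_n,b_n)_{n\ge1}$ of pairs of non-negative integers is Jacobi-Perron-admissible if for every $n\ge1$ we have $a_n\le b_n$, $b_n\ne0$, and $a_n=b_n$ implies $a_{n+1}\ne0$. The Jacobi-Perron algorithm, applied to $\mathbf v=(v_1,v_2,v_3)\in\mathbb R^3_{\ge0}$ with $v_1\le v_3$ and $v_2\le v_3$, iterates the map $\mathbf v\mapsto(v_2-av_1,\ v_3-bv_1,\ v_1)$ with $a=\lfloor v_2/v_1\rfloor$, $b=\lfloor v_3/v_1\rfloor$; if the first coordinate never vanishes, the infinite sequence $(a_n,b_n)_{n\ge1}$ of digits produced is the Jacobi-Perron expansion of $\mathbf v$. Theorem. Let $(a_n,b_n)_{n\ge1}$ be a Jacobi-Perron-admissible sequence, and for $n\ge0$ let $P_n=\Sigma_{a_1,b_1}\cdots\Sigma_{a_n,b_n}(U)$ (so $P_0=U$). There is a vector $\mathbf v\in\mathbb R^3_{>0}$ whose Jacobi-Perron expansion is $(a_n,b_n)_{n\ge1}$, and for every such $\mathbf v$ the following hold. The sequence $(P_n)_{n\ge0}$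 is a (strictly) increasing sequence of patterns contained in $\Gamma_{\mathbf v}$. Moreover, $\bigcup_{n\ge0}P_n\subsetneq\Gamma_{\mathbf v}$ if and only if there exists $\ell\ge1$ such that for every $k\ge0$ we have (1) $a_{\ell+3k}=0$, (2) $a_{\ell+3k+1}=b_{\ell+3k+1}$, and (3) $0<a_{\ell+3k+2}<b_{\ell+3k+2}$. -/

import Mathlib

namespace JacobiPerron

/-- A pointed face `[x, i]^*`: an integer vector and a type. The letters / types / coordinates
`1, 2, 3` are written `0, 1, 2 : Fin 3`. -/
structure Face where
  vec : Fin 3 → ℤ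
  type : Fin 3

/-- The unit square `[x, i]^* = {x + λ e_j + μ e_k : λ, μ ∈ [0, 1]}`, where `{i, j, k} = {1, 2, 3}`,
as a subset of `ℝ³`. -/
def Face.carrier (f : Face) : Set (Fin 3 → ℝ) :=
  {y | ∃ t : Fin 3 → ℝ, (∀ j, t j ∈ Set.Icc (0 : ℝ) 1) ∧ t f.type = 0 ∧
    ∀ j, y j = (f.vec j : ℝ) + t j}

/-- The subset of `ℝ³` that is the union of a collection of faces. -/
def region (F : Set Face) : Set (Fin 3 → ℝ) := ⋃ f ∈ F, f.carrier

/-- The faces of the discrete plane `Γ_v`: those `[x, i]^*` with `0 ≤ ⟨x, v⟩ < ⟨e_i, v⟩`. -/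
def discretePlane (v : Fin 3 → ℝ) : Set Face :=
  {f | 0 ≤ ∑ j, (f.vec j : ℝ) * v j ∧ ∑ j, (f.vec j : ℝ) * v j < v f.type}

/-- The lower half unit cube `U = [0, 1]^* ∪ [0, 2]^* ∪ [0, 3]^*`. -/
def halfCube : Set Face := {f | f.vec = 0}

/-- The abelianization of a word over the alphabet `{1, 2, 3}`. -/
def abelianization (w : List (Fin 3)) : Fin 3 → ℤ := fun i => (w.count i : ℤ)

/-- The incidence matrix of a substitution, which is given by the images of the letters:
its `j`-th column is the abelianization of `σ j`. -/
def incidence (σ : Fin 3 → List (Fin 3)) : Matrix (Fin 3) (Fin 3) ℤ :=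
  Matrix.of fun i j => abelianization (σ j) i

/-- The dual substitution `E_1^*(σ)` of a unimodular substitution `σ`, acting on collections of
faces: `[x, i]^*` is sent to all `[M_σ⁻¹ (x + P(s)), j]^*` with `σ(j) = p i s`. -/
def dualSubst (σ : Fin 3 → List (Fin 3)) (F : Set Face) : Set Face :=
  {g | ∃ f ∈ F, ∃ p s : List (Fin 3), σ g.type = p ++ f.type :: s ∧
    g.vec = (incidence σ)⁻¹.mulVec (f.vec + abelianization s)}

/-- The Jacobi-Perron substitution `1 ↦ 3`, `2 ↦ 1 3^a`, `3 ↦ 2 3^b`. -/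
def jpSubst (a b : ℕ) : Fin 3 → List (Fin 3) :=
  ![[2], 0 :: List.replicate a 2, 1 :: List.replicate b 2]

/-- The product `Σ_{a_1, b_1} ⋯ Σ_{a_n, b_n}` of dual Jacobi-Perron substitutions (so the one of
index `n` is applied first); the sequences are indexed from `1`. -/
def dualProduct (a b : ℕ → ℕ) : ℕ → Set Face → Set Face
  | 0, F => F
  | n + 1, F => dualProduct a b n (dualSubst (jpSubst (a (n + 1)) (b (n + 1))) F)

/-- The pattern `P_n = Σ_{a_1, b_1} ⋯ Σ_{a_n, b_n}(U)`; `P_0 = U`. -/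
def pattern (a b : ℕ → ℕ) (n : ℕ) : Set Face := dualProduct a b n halfCube

/-- Jacobi-Perron-admissible sequences `(a_n, b_n)_{n ≥ 1}`. The values at `0` play no role. -/
def Admissible (a b : ℕ → ℕ) : Prop :=
  ∀ n ≥ 1, a n ≤ b n ∧ b n ≠ 0 ∧ (a n = b n → a (n + 1) ≠ 0)

/-- The map iterated by the Jacobi-Perron algorithm (meaningful if `v_1 ≠ 0`). -/
noncomputable def jpMap (v : Fin 3 → ℝ) : Fin 3 → ℝ :=
  ![v 1 - (⌊v 1 / v 0⌋ : ℝ) * v 0, v 2 - (⌊v 2 / v 0⌋ : ℝ) * v 0, v 0]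

/-- `(a_n, b_n)_{n ≥ 1}` is the (infinite) Jacobi-Perron expansion of `v`: the vector `v` is
non-negative with `v_1 ≤ v_3` and `v_2 ≤ v_3`, the algorithm never meets a vector whose first
coordinate vanishes, and its digits are the `a_n` and `b_n`. -/
def IsExpansion (v : Fin 3 → ℝ) (a b : ℕ → ℕ) : Prop :=
  (∀ i, 0 ≤ v i) ∧ v 0 ≤ v 2 ∧ v 1 ≤ v 2 ∧
    ∀ n, (jpMap^[n] v) 0 ≠ 0 ∧
      (a (n + 1) : ℤ) = ⌊(jpMap^[n] v) 1 / (jpMap^[n] v) 0⌋ ∧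
      (b (n + 1) : ℤ) = ⌊(jpMap^[n] v) 2 / (jpMap^[n] v) 0⌋

end JacobiPerron

namespace JacobiPerron

/-! ### Regions and faces -/

/-- The centre of a face lies in no other face. -/
theorem Face.eq_of_center_mem {f g : Face}
    (h : (fun j => (f.vec j : ℝ) + if j = f.type then 0 else 1 / 2) ∈ g.carrier) : f = g := by
  obtain ⟨t, ht, ht0, h⟩ := h
  have ht1 : f.type = g.type := by
    by_contra hne
    have h1 := h g.type
    simp only [ht0, if_neg (Ne.symm hne), add_zero] at h1
    have h2 : ((2 * f.vec g.type + 1 : ℤ) : ℝ) = ((2 * g.vec g.type : ℤ) : ℝ) := by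
      push_cast; linarith
    have h3 := Int.cast_injective h2
    omega
  have hv : f.vec = g.vec := by
    funext j
    have h1 := h j
    by_cases hj : j = f.type
    · simp only [if_pos hj] at h1
      rw [hj, ht1, ht0] at h1
      have := hj.trans ht1
      subst this
      exact_mod_cast (by linarith : (f.vec g.type : ℝ) = g.vec g.type)
    · simp only [if_neg hj] at h1
      have h2 := ht j
      have h3 : f.vec j < g.vec j + 1 := by
        exact_mod_cast (by linarith [h2.2] : (f.vec j : ℝ) < g.vec j + 1)
      have h4 : g.vec j < f.vec j + 1 := by
        exact_mod_cast (by linarith [h2.1] : (g.vec j : ℝ) < f.vec j + 1)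
      omega
  cases f; cases g
  simp_all

theorem Face.center_mem (f : Face) :
    (fun j => (f.vec j : ℝ) + if j = f.type then 0 else 1 / 2) ∈ f.carrier := by
  refine ⟨fun j => if j = f.type then 0 else 1 / 2, fun j => ?_, by simp, fun j => rfl⟩
  dsimp only
  split_ifs <;> norm_num

theorem region_subset_region {F G : Set Face} : region F ⊆ region G ↔ F ⊆ G := by
  constructor
  · intro h f hf
    have := h (Set.mem_biUnion hf f.center_mem)
    simp only [region, Set.mem_iUnion] at this
    obtain ⟨g, hg, hm⟩ := this
    rwa [Face.eq_of_center_mem hm]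
  · intro h
    exact Set.biUnion_subset_biUnion_left h

theorem region_ssubset_region {F G : Set Face} : region F ⊂ region G ↔ F ⊂ G := by
  simp only [ssubset_iff_subset_not_subset, region_subset_region]

theorem iUnion_region {ι : Sort*} (F : ι → Set Face) :
    ⋃ n, region (F n) = region (⋃ n, F n) := by
  simp only [region, Set.biUnion_iUnion]

/-! ### The dual Jacobi-Perron substitution, seen from the image faces -/

/-- `IsParent a b f g`: the face `f` occurs in the image of the face `g` under the dual
Jacobi-Perron substitution with parameters `a` and `b`. -/
def IsParent (a b : ℕ) (f g : Face) : Prop :=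
  ∃ k : ℕ, g.vec 0 = f.vec 1 ∧ g.vec 1 = f.vec 2 ∧
    g.vec 2 = f.vec 0 + a * f.vec 1 + b * f.vec 2 - k ∧
    (f.type = 0 ∧ g.type = 2 ∧ k = 0 ∨
      f.type = 1 ∧ (g.type = 2 ∧ k < a ∨ g.type = 0 ∧ k = a) ∨
      f.type = 2 ∧ (g.type = 2 ∧ k < b ∨ g.type = 1 ∧ k = b))

theorem cons_replicate_eq_append {i c : Fin 3} {n : ℕ} {s : List (Fin 3)} (hc : c ≠ 2) :
    (∃ p, c :: List.replicate n 2 = p ++ i :: s) ↔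
      (i = 2 ∧ ∃ k < n, s = List.replicate k 2) ∨ (i = c ∧ s = List.replicate n 2) := by
  constructor
  · rintro ⟨p, hp⟩
    rcases p with - | ⟨d, p⟩
    · simp only [List.nil_append, List.cons.injEq] at hp
      exact Or.inr ⟨hp.1.symm, hp.2.symm⟩
    · simp only [List.cons_append, List.cons.injEq] at hp
      have hp2 := hp.2.symm
      rw [List.append_eq_replicate_iff] at hp2
      obtain ⟨hl, -, h2⟩ := hp2
      rw [List.length_cons, List.replicate_succ, List.cons.injEq] at h2
      refine Or.inl ⟨h2.1, s.length, ?_, h2.2⟩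
      rw [List.length_cons] at hl
      omega
  · rintro (⟨rfl, k, hk, rfl⟩ | ⟨rfl, rfl⟩)
    · refine ⟨c :: List.replicate (n - 1 - k) 2, ?_⟩
      rw [List.cons_append, ← List.replicate_succ, List.replicate_append_replicate]
      congr 2
      omega
    · exact ⟨[], rfl⟩

theorem incidence_jpSubst (a b : ℕ) :
    incidence (jpSubst a b) = !![0, 1, 0; 0, 0, 1; 1, (a : ℤ), (b : ℤ)] := by
  ext i j
  fin_cases i <;> fin_cases j <;>
    simp [incidence, jpSubst, abelianization, List.count_replicate]

theorem abelianization_replicate (k : ℕ) :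
    abelianization (List.replicate k 2) = ![0, 0, (k : ℤ)] := by
  ext i
  fin_cases i <;> simp [abelianization, List.count_replicate]

theorem eq_inv_incidence_mulVec_iff {a b : ℕ} {x y : Fin 3 → ℤ} :
    x = (incidence (jpSubst a b))⁻¹.mulVec y ↔
      x 1 = y 0 ∧ x 2 = y 1 ∧ x 0 + a * x 1 + b * x 2 = y 2 := by
  have hdet : IsUnit (incidence (jpSubst a b)).det := by
    rw [incidence_jpSubst]
    simp [Matrix.det_fin_three]
  have key : x = (incidence (jpSubst a b))⁻¹.mulVec y ↔
      (incidence (jpSubst a b)).mulVec x = y := by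
    constructor
    · rintro rfl
      rw [Matrix.mulVec_mulVec, Matrix.mul_nonsing_inv _ hdet, Matrix.one_mulVec]
    · rintro rfl
      rw [Matrix.mulVec_mulVec, Matrix.nonsing_inv_mul _ hdet, Matrix.one_mulVec]
  rw [key, incidence_jpSubst, funext_iff, Fin.forall_fin_succ, Fin.forall_fin_two]
  simp [Matrix.mulVec, dotProduct, Fin.sum_univ_three]

theorem exists_decomposition_iff {a b : ℕ} {f g : Face} :
    (∃ p s : List (Fin 3), jpSubst a b g.type = p ++ f.type :: s ∧
      g.vec = (incidence (jpSubst a b))⁻¹.mulVec (f.vec + abelianization s)) ↔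
    IsParent a b g f := by
  rw [exists_comm]
  have aux : ∀ k : ℕ, g.vec = (incidence (jpSubst a b))⁻¹.mulVec
      (f.vec + abelianization (List.replicate k 2)) ↔ f.vec 0 = g.vec 1 ∧ f.vec 1 = g.vec 2 ∧
        f.vec 2 = g.vec 0 + a * g.vec 1 + b * g.vec 2 - k := by
    intro k
    rw [eq_inv_incidence_mulVec_iff, abelianization_replicate]
    simp only [Pi.add_apply, Matrix.cons_val_zero, Matrix.cons_val_one, Matrix.cons_val, add_zero]
    constructor <;> rintro ⟨h0, h1, h2⟩ <;> refine ⟨?_, ?_, ?_⟩ <;> linarith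
  simp only [exists_and_right, IsParent]
  generalize hj : g.type = j
  fin_cases j
  · have : ∀ s, (∃ p, jpSubst a b 0 = p ++ f.type :: s) ↔ f.type = 2 ∧ s = [] := by
      intro s
      constructor
      · rintro ⟨p, hp⟩
        rcases p with - | ⟨d, p⟩
        · simp [jpSubst] at hp
          exact ⟨hp.1.symm, hp.2⟩
        · simp [jpSubst] at hp
      · rintro ⟨h1, rfl⟩
        exact ⟨[], by simp [jpSubst, h1]⟩
    simp only [Fin.zero_eta, this]
    constructor
    · rintro ⟨s, ⟨h1, rfl⟩, h2⟩
      obtain ⟨h3, h4, h5⟩ := (aux 0).1 h2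
      exact ⟨0, h3, h4, h5, Or.inl ⟨trivial, h1, rfl⟩⟩
    · rintro ⟨k, h1, h2, h3, h4⟩
      simp at h4
      obtain ⟨h4, rfl⟩ := h4
      exact ⟨[], ⟨h4, rfl⟩, (aux 0).2 ⟨h1, h2, h3⟩⟩
  · have : ∀ s, (∃ p, jpSubst a b 1 = p ++ f.type :: s) ↔ _ := fun s =>
      cons_replicate_eq_append (i := f.type) (c := 0) (n := a) (s := s) (by decide)
    simp only [Fin.mk_one, this]
    constructor
    · rintro ⟨s, ⟨h1, k, hk, rfl⟩ | ⟨h1, rfl⟩, h2⟩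
      · obtain ⟨h3, h4, h5⟩ := (aux k).1 h2
        exact ⟨k, h3, h4, h5, Or.inr (Or.inl ⟨trivial, Or.inl ⟨h1, hk⟩⟩)⟩
      · obtain ⟨h3, h4, h5⟩ := (aux a).1 h2
        exact ⟨a, h3, h4, h5, Or.inr (Or.inl ⟨trivial, Or.inr ⟨h1, rfl⟩⟩)⟩
    · rintro ⟨k, h1, h2, h3, h4⟩
      refine ⟨List.replicate k 2, ?_, (aux k).2 ⟨h1, h2, h3⟩⟩
      simp at h4
      rcases h4 with ⟨h4, h5⟩ | ⟨h4, rfl⟩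
      · exact Or.inl ⟨h4, k, h5, rfl⟩
      · exact Or.inr ⟨h4, rfl⟩
  · have : ∀ s, (∃ p, jpSubst a b 2 = p ++ f.type :: s) ↔ _ := fun s =>
      cons_replicate_eq_append (i := f.type) (c := 1) (n := b) (s := s) (by decide)
    simp only [Fin.reduceFinMk, this]
    constructor
    · rintro ⟨s, ⟨h1, k, hk, rfl⟩ | ⟨h1, rfl⟩, h2⟩
      · obtain ⟨h3, h4, h5⟩ := (aux k).1 h2
        exact ⟨k, h3, h4, h5, Or.inr (Or.inr ⟨trivial, Or.inl ⟨h1, hk⟩⟩)⟩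
      · obtain ⟨h3, h4, h5⟩ := (aux b).1 h2
        exact ⟨b, h3, h4, h5, Or.inr (Or.inr ⟨trivial, Or.inr ⟨h1, rfl⟩⟩)⟩
    · rintro ⟨k, h1, h2, h3, h4⟩
      refine ⟨List.replicate k 2, ?_, (aux k).2 ⟨h1, h2, h3⟩⟩
      simp at h4
      rcases h4 with ⟨h4, h5⟩ | ⟨h4, rfl⟩
      · exact Or.inl ⟨h4, k, h5, rfl⟩
      · exact Or.inr ⟨h4, rfl⟩

theorem mem_dualSubst_jpSubst {a b : ℕ} {F : Set Face} {f : Face} :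
    f ∈ dualSubst (jpSubst a b) F ↔ ∃ g ∈ F, IsParent a b f g := by
  simp only [dualSubst, Set.mem_ofPred_eq, exists_decomposition_iff]

theorem finite_dualSubst_jpSubst {a b : ℕ} {F : Set Face} (hF : F.Finite) :
    (dualSubst (jpSubst a b) F).Finite := by
  refine ((hF.prod (Set.finite_univ.prod (Set.finite_Iic (a + b)))).image
    fun q : Face × Fin 3 × ℕ => (⟨![q.2.2 + q.1.vec 2 - a * q.1.vec 0 - b * q.1.vec 1,
      q.1.vec 0, q.1.vec 1], q.2.1⟩ : Face)).subset ?_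
  intro f hf
  obtain ⟨g, hg, k, h0, h1, h2, h3⟩ := mem_dualSubst_jpSubst.1 hf
  refine ⟨(g, f.type, k), ⟨hg, Set.mem_univ _, ?_⟩, ?_⟩
  · simp only [Set.mem_Iic]
    omega
  · rcases f with ⟨x, i⟩
    simp only [Face.mk.injEq, and_true] at *
    ext j
    fin_cases j <;> simp [h0, h1, h2]
    ring

theorem finite_dualProduct (a b : ℕ → ℕ) (n : ℕ) {F : Set Face} (hF : F.Finite) :
    (dualProduct a b n F).Finite := by
  induction n generalizing F with
  | zero => exact hF
  | succ n ih => exact ih (finite_dualSubst_jpSubst hF)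

theorem finite_halfCube : halfCube.Finite := by
  refine (Set.finite_range fun i : Fin 3 => (⟨0, i⟩ : Face)).subset ?_
  rintro ⟨x, i⟩ h
  exact ⟨i, by simp only [halfCube, Set.mem_ofPred_eq] at h; rw [h]⟩

theorem dualProduct_mono (a b : ℕ → ℕ) (n : ℕ) {F G : Set Face} (h : F ⊆ G) :
    dualProduct a b n F ⊆ dualProduct a b n G := by
  induction n generalizing F G with
  | zero => exact h
  | succ n ih =>
    refine ih fun f hf => ?_
    obtain ⟨g, hg, hp⟩ := mem_dualSubst_jpSubst.1 hf
    exact mem_dualSubst_jpSubst.2 ⟨g, h hg, hp⟩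

theorem exists_isParent (a b : ℕ) (g : Face) : ∃ f, IsParent a b f g := by
  rcases g with ⟨y, j⟩
  fin_cases j
  · exact ⟨⟨![a + y 2 - a * y 0 - b * y 1, y 0, y 1], 1⟩, a, by simp; ring⟩
  · exact ⟨⟨![b + y 2 - a * y 0 - b * y 1, y 0, y 1], 2⟩, b, by simp; ring⟩
  · exact ⟨⟨![y 2 - a * y 0 - b * y 1, y 0, y 1], 0⟩, 0, by simp; ring⟩

theorem dualProduct_nonempty (a b : ℕ → ℕ) (n : ℕ) {F : Set Face} (hF : F.Nonempty) :
    (dualProduct a b n F).Nonempty := by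
  induction n generalizing F with
  | zero => exact hF
  | succ n ih =>
    obtain ⟨g, hg⟩ := hF
    obtain ⟨f, hf⟩ := exists_isParent (a (n + 1)) (b (n + 1)) g
    exact ih ⟨f, mem_dualSubst_jpSubst.2 ⟨g, hg, hf⟩⟩

end JacobiPerron
namespace JacobiPerron

/-! ### Orbits of the Jacobi-Perron map -/

/-- A sequence of positive vectors related by the linear maps of the Jacobi-Perron algorithm with
digits `a (n + 1)`, `b (n + 1)`. -/
structure IsOrbit (a b : ℕ → ℕ) (V : ℕ → Fin 3 → ℝ) : Prop where
  pos : ∀ n i, 0 < V n i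
  eq_zero : ∀ n, V n 0 = V (n + 1) 2
  eq_one : ∀ n, V n 1 = V (n + 1) 0 + a (n + 1) * V (n + 1) 2
  eq_two : ∀ n, V n 2 = V (n + 1) 1 + b (n + 1) * V (n + 1) 2

namespace IsOrbit

variable {a b : ℕ → ℕ} {V : ℕ → Fin 3 → ℝ}

theorem zero_lt_two (hV : IsOrbit a b V) (hab : Admissible a b) (n : ℕ) : V n 0 < V n 2 := by
  have h1 := hV.eq_zero n
  have h2 := hV.eq_two n
  have hb : (1 : ℝ) ≤ b (n + 1) := by
    exact_mod_cast Nat.one_le_iff_ne_zero.2 (hab (n + 1) (by omega)).2.1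
  nlinarith [hV.pos (n + 1) 1, hV.pos (n + 1) 2]

theorem one_lt_two (hV : IsOrbit a b V) (hab : Admissible a b) (n : ℕ) : V n 1 < V n 2 := by
  have h1 := hV.eq_one n
  have h2 := hV.eq_two n
  obtain ⟨hle, -, hne⟩ := hab (n + 1) (by omega)
  have hp := hV.pos (n + 1) 2
  rcases hle.lt_or_eq with h | h
  · have h' : (a (n + 1) : ℝ) + 1 ≤ b (n + 1) := by exact_mod_cast h
    nlinarith [hV.pos (n + 1) 1, hV.zero_lt_two hab (n + 1)]
  · have ha : (1 : ℝ) ≤ a (n + 1 + 1) := by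
      exact_mod_cast Nat.one_le_iff_ne_zero.2 (hne h)
    have h3 := hV.eq_one (n + 1)
    have h4 := hV.eq_zero (n + 1)
    rw [← h] at h2
    nlinarith [hV.pos (n + 1 + 1) 0, hV.pos (n + 1 + 1) 2]

theorem le_two (hV : IsOrbit a b V) (hab : Admissible a b) (n : ℕ) (i : Fin 3) :
    V n i ≤ V n 2 := by
  fin_cases i
  · exact (hV.zero_lt_two hab n).le
  · exact (hV.one_lt_two hab n).le
  · exact le_rfl

end IsOrbit

theorem IsExpansion.isOrbit {v : Fin 3 → ℝ} {a b : ℕ → ℕ} (hv : IsExpansion v a b)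
    (hpos : ∀ i, 0 < v i) (hab : Admissible a b) : IsOrbit a b fun n => jpMap^[n] v := by
  obtain ⟨-, -, -, hv⟩ := hv
  have h0 : ∀ n, jpMap^[n] v 0 = jpMap^[n + 1] v 2 := by
    intro n
    rw [Function.iterate_succ_apply']
    simp [jpMap]
  have h1 : ∀ n, jpMap^[n] v 1 = jpMap^[n + 1] v 0 + a (n + 1) * jpMap^[n + 1] v 2 := by
    intro n
    rw [← h0, Function.iterate_succ_apply', jpMap, ← (hv n).2.1]
    simp
  have h2 : ∀ n, jpMap^[n] v 2 = jpMap^[n + 1] v 1 + b (n + 1) * jpMap^[n + 1] v 2 := by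
    intro n
    rw [← h0, Function.iterate_succ_apply', jpMap, ← (hv n).2.2]
    simp
  have hnonneg : ∀ n, 0 ≤ jpMap^[n] v 0 ∧ 0 ≤ jpMap^[n] v 1 ∧ 0 ≤ jpMap^[n] v 2 := by
    intro n
    induction n with
    | zero => exact ⟨(hpos 0).le, (hpos 1).le, (hpos 2).le⟩
    | succ n ih =>
      have hp : 0 < jpMap^[n] v 0 := lt_of_le_of_ne ih.1 (hv n).1.symm
      rw [Function.iterate_succ_apply']
      refine ⟨?_, ?_, ?_⟩
      · simpa [jpMap] using (le_div_iff₀ hp).1 (Int.floor_le (jpMap^[n] v 1 / jpMap^[n] v 0))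
      · simpa [jpMap] using (le_div_iff₀ hp).1 (Int.floor_le (jpMap^[n] v 2 / jpMap^[n] v 0))
      · simpa [jpMap] using ih.1
  have hp : ∀ n, 0 < jpMap^[n] v 0 := fun n => lt_of_le_of_ne (hnonneg n).1 (hv n).1.symm
  refine ⟨fun n i => ?_, h0, h1, h2⟩
  fin_cases i
  · exact hp n
  · show 0 < jpMap^[n] v 1
    rw [h1]
    have := hp (n + 1)
    have := (hnonneg (n + 1)).2.2
    positivity
  · show 0 < jpMap^[n] v 2
    rw [h2, ← h0]
    have hb : 0 < b (n + 1) := Nat.pos_of_ne_zero (hab (n + 1) (by omega)).2.1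
    have := hp n
    have := (hnonneg (n + 1)).2.1
    positivity

theorem IsOrbit.isExpansion {a b : ℕ → ℕ} {V : ℕ → Fin 3 → ℝ} (hV : IsOrbit a b V)
    (hab : Admissible a b) : IsExpansion (V 0) a b := by
  have hfloor : ∀ n, ⌊V n 1 / V n 0⌋ = (a (n + 1) : ℤ) ∧ ⌊V n 2 / V n 0⌋ = (b (n + 1) : ℤ) := by
    intro n
    have hp := hV.pos n 0
    have h0 := hV.eq_zero n
    constructor
    · rw [Int.floor_eq_iff, le_div_iff₀ hp, div_lt_iff₀ hp, hV.eq_one n, h0]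
      push_cast
      constructor <;> nlinarith [hV.pos (n + 1) 0, hV.zero_lt_two hab (n + 1)]
    · rw [Int.floor_eq_iff, le_div_iff₀ hp, div_lt_iff₀ hp, hV.eq_two n, h0]
      push_cast
      constructor <;> nlinarith [hV.pos (n + 1) 1, hV.one_lt_two hab (n + 1)]
  have hiter : ∀ n, jpMap^[n] (V 0) = V n := by
    intro n
    induction n with
    | zero => rfl
    | succ n ih =>
      rw [Function.iterate_succ_apply', ih, jpMap, (hfloor n).1, (hfloor n).2]
      ext i
      fin_cases i
      · simp [hV.eq_one n, hV.eq_zero n]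
      · simp [hV.eq_two n, hV.eq_zero n]
      · simp [hV.eq_zero n]
  refine ⟨fun i => (hV.pos 0 i).le, hV.le_two hab 0 0, hV.le_two hab 0 1, fun n => ?_⟩
  rw [hiter]
  exact ⟨(hV.pos n 0).ne', (hfloor n).1.symm, (hfloor n).2.symm⟩

/-- Finite stretches of orbits exist, in the closed cone containing all orbits. -/
theorem exists_partial_orbit (N : ℕ) (a b : ℕ → ℕ) (hab : Admissible a b) :
    ∃ V : ℕ → Fin 3 → ℝ, (∀ n i, 0 ≤ V n i ∧ V n i ≤ V n 2) ∧ (∀ n, V n 2 ≤ V 0 2) ∧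
      0 < V 0 2 ∧ (∀ n < N, V n 0 = V (n + 1) 2 ∧
        V n 1 = V (n + 1) 0 + a (n + 1) * V (n + 1) 2 ∧
        V n 2 = V (n + 1) 1 + b (n + 1) * V (n + 1) 2) ∧ (a 1 ≠ 0 → V 0 0 ≤ V 0 1) := by
  induction N generalizing a b with
  | zero => exact ⟨fun _ _ => 1, by simp, by simp, by simp, by simp, by simp⟩
  | succ N ih =>
    obtain ⟨V, h1, h2, h3, h4, h5⟩ := ih (fun n => a (n + 1)) (fun n => b (n + 1))
      fun n hn => hab (n + 1) (by omega)
    obtain ⟨hle, hb, hne⟩ := hab 1 le_rfl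
    have hb' : (1 : ℝ) ≤ b 1 := by exact_mod_cast Nat.one_le_iff_ne_zero.2 hb
    have hle' : (a 1 : ℝ) ≤ b 1 := by exact_mod_cast hle
    have h10 := h1 0 0
    have h11 := h1 0 1
    have hmul : V 0 2 ≤ b 1 * V 0 2 := le_mul_of_one_le_left h3.le hb'
    have hone : V 0 0 + a 1 * V 0 2 ≤ V 0 1 + b 1 * V 0 2 := by
      rcases hle.lt_or_eq with h | h
      · have h' : (a 1 : ℝ) + 1 ≤ b 1 := by exact_mod_cast h
        nlinarith
      · rw [h]
        linarith [h5 (hne h)]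
    have ha : (0 : ℝ) ≤ a 1 * V 0 2 := by positivity
    obtain ⟨W, hW, hWV⟩ : ∃ W : ℕ → Fin 3 → ℝ,
        W 0 = ![V 0 2, V 0 0 + a 1 * V 0 2, V 0 1 + b 1 * V 0 2] ∧ ∀ n, W (n + 1) = V n :=
      ⟨fun n => Nat.casesOn n ![V 0 2, V 0 0 + a 1 * V 0 2, V 0 1 + b 1 * V 0 2] V, rfl,
        fun _ => rfl⟩
    have hW0 : W 0 0 = V 0 2 := by simp [hW]
    have hW1 : W 0 1 = V 0 0 + a 1 * V 0 2 := by simp [hW]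
    have hW2 : W 0 2 = V 0 1 + b 1 * V 0 2 := by simp [hW]
    refine ⟨W, ?_, ?_, by linarith, ?_, ?_⟩
    · rintro (- | n) i
      · have hi : i = 0 ∨ i = 1 ∨ i = 2 := by omega
        rcases hi with rfl | rfl | rfl <;> constructor <;> linarith
      · rw [hWV]
        exact h1 n i
    · rintro (- | n)
      · exact le_rfl
      · rw [hWV]
        linarith [h2 n]
    · rintro (- | n) hn
      · rw [hWV]
        exact ⟨hW0, hW1, hW2⟩
      · rw [hWV, hWV]
        exact h4 n (by omega)
    · intro h
      have h' : (1 : ℝ) ≤ a 1 := by exact_mod_cast Nat.one_le_iff_ne_zero.2 h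
      nlinarith

theorem exists_isOrbit {a b : ℕ → ℕ} (hab : Admissible a b) : ∃ V, IsOrbit a b V := by
  let box : Set (ℕ → Fin 3 → ℝ) :=
    Set.univ.pi fun _ => Set.univ.pi fun _ => Set.Icc (0 : ℝ) 1
  let C : ℕ → Set (ℕ → Fin 3 → ℝ) := fun N => box ∩ {V | (∀ n i, V n i ≤ V n 2) ∧ V 0 2 = 1 ∧
    ∀ n < N, V n 0 = V (n + 1) 2 ∧ V n 1 = V (n + 1) 0 + a (n + 1) * V (n + 1) 2 ∧
      V n 2 = V (n + 1) 1 + b (n + 1) * V (n + 1) 2}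
  have hbox : IsCompact box :=
    isCompact_univ_pi fun _ => isCompact_univ_pi fun _ => isCompact_Icc
  have hclosed : ∀ N, IsClosed (C N) := by
    intro N
    refine hbox.isClosed.inter ?_
    simp only [Set.ofPred_and, Set.ofPred_forall]
    refine IsClosed.inter ?_ (IsClosed.inter ?_ ?_)
    · exact isClosed_iInter fun n => isClosed_iInter fun i =>
        isClosed_le (by fun_prop) (by fun_prop)
    · exact isClosed_eq (by fun_prop) (by fun_prop)
    · refine isClosed_iInter fun n => isClosed_iInter fun _ => IsClosed.inter ?_
        (IsClosed.inter ?_ ?_) <;> exact isClosed_eq (by fun_prop) (by fun_prop)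
  obtain ⟨V, hV⟩ : (⋂ N, C N).Nonempty := by
    refine IsCompact.nonempty_iInter_of_sequence_nonempty_isCompact_isClosed C ?_ ?_
      (hbox.of_isClosed_subset (hclosed 0) Set.inter_subset_left) hclosed
    · rintro N V ⟨h1, h2, h3, h4⟩
      exact ⟨h1, h2, h3, fun n hn => h4 n (by omega)⟩
    · intro N
      obtain ⟨V, h1, h2, h3, h4, -⟩ := exists_partial_orbit N a b hab
      refine ⟨fun n i => V n i / V 0 2, ?_, ?_, ?_, ?_⟩
      · intro n _ i _
        exact ⟨div_nonneg (h1 n i).1 h3.le, (div_le_one h3).2 ((h1 n i).2.trans (h2 n))⟩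
      · intro n i
        exact div_le_div_of_nonneg_right (h1 n i).2 h3.le
      · exact div_self h3.ne'
      · intro n hn
        obtain ⟨h5, h6, h7⟩ := h4 n hn
        dsimp only
        rw [h5, h6, h7]
        refine ⟨rfl, ?_, ?_⟩ <;> ring
  simp only [Set.mem_iInter] at hV
  have hmem : ∀ n i, 0 ≤ V n i := fun n i => ((hV 0).1 n trivial i trivial).1
  have hle := (hV 0).2.1
  have hrel := fun n => (hV (n + 1)).2.2.2 n (Nat.lt_succ_self n)
  have hpos2 : ∀ n, 0 < V n 2 := by
    intro n
    induction n with
    | zero => rw [(hV 0).2.2.1]; exact one_pos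
    | succ n ih =>
      by_contra h
      have h2 : V (n + 1) 2 = 0 := le_antisymm (not_lt.1 h) (hmem _ _)
      have h1 : V (n + 1) 1 = 0 := le_antisymm (h2 ▸ hle (n + 1) 1) (hmem _ _)
      rw [(hrel n).2.2, h1, h2] at ih
      simp at ih
  refine ⟨V, fun n i => ?_, fun n => (hrel n).1, fun n => (hrel n).2.1, fun n => (hrel n).2.2⟩
  have hpos0 : ∀ n, 0 < V n 0 := fun n => (hrel n).1 ▸ hpos2 (n + 1)
  fin_cases i
  · exact hpos0 n
  · show 0 < V n 1
    rw [(hrel n).2.1]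
    have := hpos0 (n + 1)
    have := hpos2 (n + 1)
    positivity
  · exact hpos2 n

end JacobiPerron
namespace JacobiPerron

/-! ### Ancestors of faces in discrete planes -/

theorem mem_discretePlane {v : Fin 3 → ℝ} {f : Face} :
    f ∈ discretePlane v ↔ 0 ≤ f.vec 0 * v 0 + f.vec 1 * v 1 + f.vec 2 * v 2 ∧
      f.vec 0 * v 0 + f.vec 1 * v 1 + f.vec 2 * v 2 < v f.type := by
  simp [discretePlane, Fin.sum_univ_three]

theorem exists_digit (c : ℕ) {h w : ℝ} (hw : 0 < w) (hh : 0 ≤ h) :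
    (∃ k < c, k * w ≤ h ∧ h < k * w + w) ∨ c * w ≤ h := by
  by_cases hc : c * w ≤ h
  · exact Or.inr hc
  · refine Or.inl ⟨⌊h / w⌋₊, ?_, ?_, ?_⟩
    · rw [Nat.floor_lt (by positivity), div_lt_iff₀ hw]
      exact not_le.1 hc
    · rw [← le_div_iff₀ hw]
      exact Nat.floor_le (by positivity)
    · have := (div_lt_iff₀ hw).1 (Nat.lt_floor_add_one (h / w))
      linarith

theorem digit_lt {k l : ℕ} {h w : ℝ} (hw : 0 < w) (hk : k * w ≤ h) (hl : h < l * w) : k < l := by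
  have : (k : ℝ) < l := lt_of_mul_lt_mul_right (hk.trans_lt hl) hw.le
  exact_mod_cast this

theorem digit_unique {k l : ℕ} {h w : ℝ} (hw : 0 < w) (hk : k * w ≤ h) (hk' : h < k * w + w)
    (hl : l * w ≤ h) (hl' : h < l * w + w) : k = l := by
  have h1 := digit_lt (k := k) (l := l + 1) hw hk (by push_cast; linarith)
  have h2 := digit_lt (k := l) (l := k + 1) hw hl (by push_cast; linarith)
  omega

namespace IsOrbit

variable {a b : ℕ → ℕ} {V : ℕ → Fin 3 → ℝ}

/-- The linear form defining the discrete plane, evaluated at a parent. -/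
theorem height_parent (hV : IsOrbit a b V) (n : ℕ) {x y : Fin 3 → ℤ} {k : ℕ}
    (h0 : y 0 = x 1) (h1 : y 1 = x 2)
    (h2 : y 2 = x 0 + a (n + 1) * x 1 + b (n + 1) * x 2 - k) :
    y 0 * V (n + 1) 0 + y 1 * V (n + 1) 1 + y 2 * V (n + 1) 2 =
      x 0 * V n 0 + x 1 * V n 1 + x 2 * V n 2 - k * V (n + 1) 2 := by
  rw [hV.eq_zero n, hV.eq_one n, hV.eq_two n, h0, h1, h2]
  push_cast
  ring

theorem exists_parent (hV : IsOrbit a b V) {n : ℕ} {f : Face} (hf : f ∈ discretePlane (V n)) :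
    ∃ g ∈ discretePlane (V (n + 1)), IsParent (a (n + 1)) (b (n + 1)) f g := by
  rw [mem_discretePlane] at hf
  obtain ⟨h1, h2⟩ := hf
  have hp := hV.pos (n + 1) 2
  have key : ∀ (k : ℕ) (j : Fin 3),
      k * V (n + 1) 2 ≤ f.vec 0 * V n 0 + f.vec 1 * V n 1 + f.vec 2 * V n 2 →
      f.vec 0 * V n 0 + f.vec 1 * V n 1 + f.vec 2 * V n 2 < k * V (n + 1) 2 + V (n + 1) j →
      (f.type = 0 ∧ j = 2 ∧ k = 0 ∨
        f.type = 1 ∧ (j = 2 ∧ k < a (n + 1) ∨ j = 0 ∧ k = a (n + 1)) ∨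
        f.type = 2 ∧ (j = 2 ∧ k < b (n + 1) ∨ j = 1 ∧ k = b (n + 1))) →
      ∃ g ∈ discretePlane (V (n + 1)), IsParent (a (n + 1)) (b (n + 1)) f g := by
    intro k j h3 h4 h5
    refine ⟨⟨![f.vec 1, f.vec 2, f.vec 0 + a (n + 1) * f.vec 1 + b (n + 1) * f.vec 2 - k], j⟩, ?_,
      k, rfl, rfl, rfl, h5⟩
    rw [mem_discretePlane, hV.height_parent n rfl rfl rfl]
    constructor <;> linarith
  have hj : f.type = 0 ∨ f.type = 1 ∨ f.type = 2 := by omega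
  rcases hj with hj | hj | hj <;> rw [hj] at h2
  · have he := hV.eq_zero n
    refine key 0 2 ?_ ?_ (by simp [hj]) <;> push_cast <;> linarith
  · have he := hV.eq_one n
    rcases exists_digit (a (n + 1)) hp h1 with ⟨k, hk, h3, h4⟩ | h3
    · exact key k 2 h3 h4 (by simp [hj, hk])
    · exact key (a (n + 1)) 0 h3 (by linarith) (by simp [hj])
  · have he := hV.eq_two n
    rcases exists_digit (b (n + 1)) hp h1 with ⟨k, hk, h3, h4⟩ | h3
    · exact key k 2 h3 h4 (by simp [hj, hk])
    · exact key (b (n + 1)) 1 h3 (by linarith) (by simp [hj])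

theorem mem_of_isParent (hV : IsOrbit a b V) {n : ℕ} {f g : Face}
    (hg : g ∈ discretePlane (V (n + 1))) (hfg : IsParent (a (n + 1)) (b (n + 1)) f g) :
    f ∈ discretePlane (V n) := by
  obtain ⟨k, h0, h1, h2, h3⟩ := hfg
  rw [mem_discretePlane, hV.height_parent n h0 h1 h2] at hg
  rw [mem_discretePlane]
  have hp := hV.pos (n + 1) 2
  have hk : (0 : ℝ) ≤ k * V (n + 1) 2 := by positivity
  refine ⟨by linarith, ?_⟩
  have hmul : ∀ c : ℕ, k < c → k * V (n + 1) 2 + V (n + 1) 2 ≤ c * V (n + 1) 2 := by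
    intro c hc
    have : (k : ℝ) + 1 ≤ c := by exact_mod_cast hc
    nlinarith
  rcases h3 with ⟨hf, hg', rfl⟩ | ⟨hf, ⟨hg', hc⟩ | ⟨hg', rfl⟩⟩ | ⟨hf, ⟨hg', hc⟩ | ⟨hg', rfl⟩⟩ <;>
    rw [hg'] at hg <;> rw [hf]
  · rw [hV.eq_zero n] at hg ⊢
    push_cast at hg
    linarith
  · rw [hV.eq_one n] at hg ⊢
    linarith [hmul _ hc, hV.pos (n + 1) 0]
  · rw [hV.eq_one n] at hg ⊢
    linarith
  · rw [hV.eq_two n] at hg ⊢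
    linarith [hmul _ hc, hV.pos (n + 1) 1]
  · rw [hV.eq_two n] at hg ⊢
    linarith

theorem parent_unique (hV : IsOrbit a b V) {n : ℕ} {f g g' : Face}
    (hg : g ∈ discretePlane (V (n + 1))) (hfg : IsParent (a (n + 1)) (b (n + 1)) f g)
    (hg' : g' ∈ discretePlane (V (n + 1))) (hfg' : IsParent (a (n + 1)) (b (n + 1)) f g') :
    g = g' := by
  obtain ⟨k, h0, h1, h2, h3⟩ := hfg
  obtain ⟨k', h0', h1', h2', h3'⟩ := hfg'
  rw [mem_discretePlane, hV.height_parent n h0 h1 h2] at hg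
  rw [mem_discretePlane, hV.height_parent n h0' h1' h2'] at hg'
  have hp := hV.pos (n + 1) 2
  suffices hk : k = k' ∧ g.type = g'.type by
    obtain ⟨rfl, ht⟩ := hk
    cases g
    cases g'
    simp only [Face.mk.injEq] at *
    refine ⟨?_, ht⟩
    ext j
    have hj : j = 0 ∨ j = 1 ∨ j = 2 := by omega
    rcases hj with rfl | rfl | rfl
    · rw [h0, h0']
    · rw [h1, h1']
    · rw [h2, h2']
  obtain ⟨hg1, hg2⟩ := hg
  obtain ⟨hg1', hg2'⟩ := hg'
  have huniq : g.type = 2 → g'.type = 2 → k = k' := fun ht ht' =>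
    digit_unique hp (sub_nonneg.1 hg1) (by rw [ht] at hg2; linarith) (sub_nonneg.1 hg1')
      (by rw [ht'] at hg2'; linarith)
  have hlt : g.type = 2 → k' < k + 1 := fun ht =>
    digit_lt hp (sub_nonneg.1 hg1') (by rw [ht] at hg2; push_cast; linarith)
  have hlt' : g'.type = 2 → k < k' + 1 := fun ht' =>
    digit_lt hp (sub_nonneg.1 hg1) (by rw [ht'] at hg2'; push_cast; linarith)
  have hf01 : (0 : Fin 3) ≠ 1 := by decide
  have hf02 : (0 : Fin 3) ≠ 2 := by decide
  have hf12 : (1 : Fin 3) ≠ 2 := by decide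
  rcases h3 with ⟨hf, ht, hc⟩ | ⟨hf, ⟨ht, hc⟩ | ⟨ht, hc⟩⟩ | ⟨hf, ⟨ht, hc⟩ | ⟨ht, hc⟩⟩ <;>
    rcases h3' with ⟨hf', ht', hc'⟩ | ⟨hf', ⟨ht', hc'⟩ | ⟨ht', hc'⟩⟩ |
      ⟨hf', ⟨ht', hc'⟩ | ⟨ht', hc'⟩⟩ <;>
    simp_all <;> omega

theorem dualSubst_subset (hV : IsOrbit a b V) {n : ℕ} {F : Set Face}
    (hF : F ⊆ discretePlane (V (n + 1))) :
    dualSubst (jpSubst (a (n + 1)) (b (n + 1))) F ⊆ discretePlane (V n) := by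
  intro f hf
  obtain ⟨g, hg, hfg⟩ := mem_dualSubst_jpSubst.1 hf
  exact hV.mem_of_isParent (hF hg) hfg

theorem dualProduct_subset (hV : IsOrbit a b V) (n : ℕ) {F : Set Face}
    (hF : F ⊆ discretePlane (V n)) : dualProduct a b n F ⊆ discretePlane (V 0) := by
  induction n generalizing F with
  | zero => exact hF
  | succ n ih => exact ih (hV.dualSubst_subset hF)

theorem halfCube_subset (hV : IsOrbit a b V) (n : ℕ) : halfCube ⊆ discretePlane (V n) := by
  intro f hf
  have hf : f.vec = 0 := hf
  simp [mem_discretePlane, hf, hV.pos n]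

end IsOrbit

/-- A sequence of faces of the successive discrete planes, each followed by its parent. -/
structure IsLineage (a b : ℕ → ℕ) (V : ℕ → Fin 3 → ℝ) (c : ℕ → Face) : Prop where
  mem : ∀ n, c n ∈ discretePlane (V n)
  parent : ∀ n, IsParent (a (n + 1)) (b (n + 1)) (c n) (c (n + 1))

namespace IsOrbit

variable {a b : ℕ → ℕ} {V : ℕ → Fin 3 → ℝ}

theorem exists_lineage (hV : IsOrbit a b V) {f : Face} (hf : f ∈ discretePlane (V 0)) :
    ∃ c, IsLineage a b V c ∧ c 0 = f := by
  choose p hp hp' using fun (n : ℕ) (f : discretePlane (V n)) => hV.exists_parent f.2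
  let c : ∀ n, discretePlane (V n) := fun n =>
    Nat.rec (motive := fun n => discretePlane (V n)) ⟨f, hf⟩ (fun n g => ⟨p n g, hp n g⟩) n
  refine ⟨fun n => (c n).1, ⟨fun n => (c n).2, fun n => hp' n (c n)⟩, ?_⟩
  rfl

theorem mem_dualSubst_iff (hV : IsOrbit a b V) {c : ℕ → Face} (hc : IsLineage a b V c) (n : ℕ)
    {F : Set Face} (hF : F ⊆ discretePlane (V (n + 1))) :
    c n ∈ dualSubst (jpSubst (a (n + 1)) (b (n + 1))) F ↔ c (n + 1) ∈ F := by
  rw [mem_dualSubst_jpSubst]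
  constructor
  · rintro ⟨g, hg, hp⟩
    rwa [hV.parent_unique (hc.mem (n + 1)) (hc.parent n) (hF hg) hp]
  · exact fun h => ⟨_, h, hc.parent n⟩

theorem mem_dualProduct_iff (hV : IsOrbit a b V) {c : ℕ → Face} (hc : IsLineage a b V c) (n : ℕ)
    {F : Set Face} (hF : F ⊆ discretePlane (V n)) : c 0 ∈ dualProduct a b n F ↔ c n ∈ F := by
  induction n generalizing F with
  | zero => rfl
  | succ n ih => exact (ih (hV.dualSubst_subset hF)).trans (hV.mem_dualSubst_iff hc n hF)

theorem mem_pattern_iff (hV : IsOrbit a b V) {c : ℕ → Face} (hc : IsLineage a b V c) (n : ℕ) :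
    c 0 ∈ pattern a b n ↔ (c n).vec = 0 :=
  hV.mem_dualProduct_iff hc n (hV.halfCube_subset n)

/-- The half cube is contained in its image. -/
theorem halfCube_subset_dualSubst {a b : ℕ} (hb : b ≠ 0) :
    halfCube ⊆ dualSubst (jpSubst a b) halfCube := by
  rintro ⟨x, i⟩ (rfl : x = 0)
  rw [mem_dualSubst_jpSubst]
  have hi : i = 0 ∨ i = 1 ∨ i = 2 := by omega
  rcases hi with rfl | rfl | rfl
  · exact ⟨⟨0, 2⟩, rfl, 0, by simp⟩
  · rcases Nat.eq_zero_or_pos a with rfl | ha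
    · exact ⟨⟨0, 0⟩, rfl, 0, by simp⟩
    · exact ⟨⟨0, 2⟩, rfl, 0, by simp [ha]⟩
  · exact ⟨⟨0, 2⟩, rfl, 0, by simp [Nat.pos_of_ne_zero hb]⟩

theorem exists_mem_dualSubst_halfCube {a b : ℕ} (hb : b ≠ 0) :
    ∃ f ∈ dualSubst (jpSubst a b) halfCube, f.vec ≠ 0 := by
  refine ⟨⟨![b, 0, 0], 2⟩, mem_dualSubst_jpSubst.2 ⟨⟨0, 1⟩, rfl, b, by simp⟩, fun h => ?_⟩
  have := congrFun h 0
  simp [hb] at this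

theorem pattern_strictMono (hV : IsOrbit a b V) (hab : Admissible a b) :
    StrictMono (pattern a b) := by
  refine strictMono_nat_of_lt_succ fun n => ?_
  have hb := (hab (n + 1) (by omega)).2.1
  refine ⟨dualProduct_mono a b n (halfCube_subset_dualSubst hb), fun hsub => ?_⟩
  obtain ⟨g, hg, hg0⟩ := exists_mem_dualSubst_halfCube (a := a (n + 1)) hb
  obtain ⟨f, hf⟩ := dualProduct_nonempty a b n (Set.singleton_nonempty g)
  have hgV := hV.dualSubst_subset (hV.halfCube_subset (n + 1)) hg
  have hgV' : {g} ⊆ discretePlane (V n) := Set.singleton_subset_iff.2 hgV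
  obtain ⟨c, hc, rfl⟩ := hV.exists_lineage (hV.dualProduct_subset n hgV' hf)
  have h1 : c n = g := (hV.mem_dualProduct_iff hc n hgV').1 hf
  have h2 := (hV.mem_pattern_iff hc n).1
    (hsub (dualProduct_mono a b n (Set.singleton_subset_iff.2 hg) hf))
  exact hg0 (h1 ▸ h2)

theorem vec_eq_zero_of_le (hV : IsOrbit a b V) (hab : Admissible a b) {c : ℕ → Face}
    (hc : IsLineage a b V c) {m n : ℕ} (hmn : m ≤ n) (h : (c m).vec = 0) : (c n).vec = 0 :=
  (hV.mem_pattern_iff hc n).1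
    ((hV.pattern_strictMono hab).monotone hmn ((hV.mem_pattern_iff hc m).2 h))

end IsOrbit
end JacobiPerron
namespace JacobiPerron

/-! ### Neighbouring faces -/

/-- Two faces are close if their vectors differ by at most `1` in each coordinate. -/
def Close (x y : Fin 3 → ℤ) : Prop := ∀ i, |x i - y i| ≤ 1

theorem Close.symm {x y : Fin 3 → ℤ} (h : Close x y) : Close y x := fun i => by
  rw [abs_sub_comm]
  exact h i

theorem digit_le {a b k : ℕ} {i j : Fin 3} (hab : a ≤ b)
    (h : i = 0 ∧ j = 2 ∧ k = 0 ∨ i = 1 ∧ (j = 2 ∧ k < a ∨ j = 0 ∧ k = a) ∨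
      i = 2 ∧ (j = 2 ∧ k < b ∨ j = 1 ∧ k = b)) : k ≤ b := by
  omega

/-- A vector of the discrete plane with a nonzero coordinate has a close one with smaller
`ℓ¹` norm. -/
theorem exists_close_smaller {v : Fin 3 → ℝ} (hpos : ∀ i, 0 < v i) (hle : ∀ i, v i ≤ v 2)
    {f : Face} (hf : f ∈ discretePlane v) (h0 : f.vec ≠ 0) :
    ∃ g ∈ discretePlane v, Close f.vec g.vec ∧ ∑ i, (g.vec i).natAbs < ∑ i, (f.vec i).natAbs := by
  obtain ⟨h1, h2⟩ := hf
  have h2 := h2.trans_le (hle f.type)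
  set x := f.vec with hx
  have key : ∀ d : Fin 3 → ℤ, (∀ i, |d i| ≤ 1) → 0 ≤ ∑ i, (x i - d i : ℝ) * v i →
      ∑ i, (x i - d i : ℝ) * v i < v 2 →
      ∑ i, (x i - d i).natAbs < ∑ i, (x i).natAbs → ∃ g ∈ discretePlane v, Close x g.vec ∧
        ∑ i, (g.vec i).natAbs < ∑ i, (x i).natAbs := by
    intro d hd h3 h4 h5
    refine ⟨⟨fun i => x i - d i, 2⟩, ⟨?_, ?_⟩, fun i => ?_, h5⟩
    · simpa using h3
    · simpa using h4
    · simpa using hd i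
  have hsum : ∀ d : Fin 3 → ℤ,
      ∑ i, (x i - d i : ℝ) * v i = ∑ i, x i * v i - ∑ i, d i * v i := by
    intro d
    simp only [sub_mul, Finset.sum_sub_distrib]
  have hsingle : ∀ p, ∑ i, ((Pi.single p 1 : Fin 3 → ℤ) i : ℝ) * v i = v p := by
    intro p
    rw [Finset.sum_eq_single p]
    · simp
    · intro i _ hi
      simp [Pi.single_eq_of_ne hi]
    · simp
  obtain ⟨p, hp⟩ : ∃ p, 0 < x p := by
    by_contra! h
    apply h0
    have hz := (Finset.sum_eq_zero_iff_of_nonpos fun i _ =>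
      mul_nonpos_of_nonpos_of_nonneg (Int.cast_nonpos.2 (h i)) (hpos i).le).1
      (le_antisymm (Finset.sum_nonpos fun i _ =>
        mul_nonpos_of_nonpos_of_nonneg (Int.cast_nonpos.2 (h i)) (hpos i).le) h1)
    funext i
    have := (mul_eq_zero.1 (hz i (Finset.mem_univ i))).resolve_right (hpos i).ne'
    exact_mod_cast this
  by_cases hvp : v p ≤ ∑ i, x i * v i
  · refine key (Pi.single p 1) (fun i => ?_) ?_ ?_ ?_
    · rw [Pi.single_apply]
      split_ifs <;> simp
    · rw [hsum, hsingle]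
      linarith
    · rw [hsum, hsingle]
      linarith [hpos p]
    · refine Finset.sum_lt_sum (fun i _ => ?_) ⟨p, Finset.mem_univ p, ?_⟩
      · rw [Pi.single_apply]
        split_ifs with h
        · subst h; omega
        · simp
      · rw [Pi.single_eq_same]
        omega
  rw [not_le] at hvp
  obtain ⟨q, hq⟩ : ∃ q, x q < 0 := by
    by_contra! h
    have h3 : x p * v p ≤ ∑ i, x i * v i := Finset.single_le_sum
      (f := fun i => (x i : ℝ) * v i)
      (fun i _ => mul_nonneg (Int.cast_nonneg (h i)) (hpos i).le) (Finset.mem_univ p)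
    have h4 : (1 : ℝ) ≤ x p := by exact_mod_cast hp
    nlinarith [hpos p]
  have hpq : p ≠ q := by
    rintro rfl
    omega
  by_cases hvq : 0 ≤ ∑ i, x i * v i - v p + v q
  · have hsum' : ∑ i, ((Pi.single p 1 - Pi.single q 1 : Fin 3 → ℤ) i : ℝ) * v i = v p - v q := by
      rw [← hsingle p, ← hsingle q, ← Finset.sum_sub_distrib]
      refine Finset.sum_congr rfl fun i _ => ?_
      rw [Pi.sub_apply]
      push_cast
      ring
    refine key (Pi.single p 1 - Pi.single q 1) (fun i => ?_) ?_ ?_ ?_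
    · rw [Pi.sub_apply, Pi.single_apply, Pi.single_apply]
      split_ifs <;> simp
    · rw [hsum, hsum']
      linarith
    · rw [hsum, hsum']
      linarith [hle q]
    · refine Finset.sum_lt_sum (fun i _ => ?_) ⟨p, Finset.mem_univ p, ?_⟩
      · rw [Pi.sub_apply, Pi.single_apply, Pi.single_apply]
        split_ifs with h h' h'
        · omega
        · subst h; omega
        · subst h'; omega
        · simp
      · rw [Pi.sub_apply, Pi.single_eq_same, Pi.single_eq_of_ne hpq]
        omega
  · have hsum' : ∑ i, ((-Pi.single q 1 : Fin 3 → ℤ) i : ℝ) * v i = - v q := by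
      rw [← hsingle q, ← Finset.sum_neg_distrib]
      refine Finset.sum_congr rfl fun i _ => ?_
      rw [Pi.neg_apply]
      push_cast
      ring
    refine key (-Pi.single q 1) (fun i => ?_) ?_ ?_ ?_
    · rw [Pi.neg_apply, Pi.single_apply]
      split_ifs <;> simp
    · rw [hsum, hsum']
      linarith [hpos q]
    · rw [hsum, hsum']
      linarith [hle p]
    · refine Finset.sum_lt_sum (fun i _ => ?_) ⟨q, Finset.mem_univ q, ?_⟩
      · rw [Pi.neg_apply, Pi.single_apply]
        split_ifs with h
        · subst h; omega
        · simp
      · rw [Pi.neg_apply, Pi.single_eq_same]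
        omega

namespace IsOrbit

variable {a b : ℕ → ℕ} {V : ℕ → Fin 3 → ℝ}

theorem parent_sub_le (hV : IsOrbit a b V) (hab : Admissible a b) {n : ℕ} {f f' g g' : Face}
    (hfg : Close f.vec f'.vec)
    (hg : g ∈ discretePlane (V (n + 1))) (hp : IsParent (a (n + 1)) (b (n + 1)) f g)
    (hg' : g' ∈ discretePlane (V (n + 1))) (hp' : IsParent (a (n + 1)) (b (n + 1)) f' g') :
    g.vec 2 - g'.vec 2 ≤ 1 := by
  by_contra! hd
  rw [mem_discretePlane] at hg hg'
  have h3 := hg.2.trans_le (hV.le_two hab _ _)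
  have h4 := hg'.1
  have h02 := hV.zero_lt_two hab (n + 1)
  have h12 := hV.one_lt_two hab (n + 1)
  have p0 := hV.pos (n + 1) 0
  have p1 := hV.pos (n + 1) 1
  obtain ⟨k, e0, e1, e2, hk⟩ := hp
  obtain ⟨k', e0', e1', e2', hk'⟩ := hp'
  have hle := (hab (n + 1) (by omega)).1
  have hkb := digit_le hle hk'
  have c0 := abs_le.1 (hfg 0)
  have c1 := abs_le.1 (hfg 1)
  have c2 := abs_le.1 (hfg 2)
  rw [← e0, ← e0'] at c1
  rw [← e1, ← e1'] at c2
  have hd' : (2 : ℝ) ≤ g.vec 2 - g'.vec 2 := by exact_mod_cast hd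
  have hsub : (g.vec 0 - g'.vec 0 : ℝ) * V (n + 1) 0 + (g.vec 1 - g'.vec 1 : ℝ) * V (n + 1) 1
      + (g.vec 2 - g'.vec 2 : ℝ) * V (n + 1) 2 < V (n + 1) 2 := by linarith
  have c1' : (-1 : ℝ) ≤ g.vec 0 - g'.vec 0 := by exact_mod_cast c1.1
  have c2' : (-1 : ℝ) ≤ g.vec 1 - g'.vec 1 := by exact_mod_cast c2.1
  have hm : g.vec 0 - g'.vec 0 = -1 ∧ g.vec 1 - g'.vec 1 = -1 := by
    by_contra! hne
    by_cases h : g.vec 0 - g'.vec 0 = -1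
    · have h' : (0 : ℝ) ≤ g.vec 1 - g'.vec 1 := by
        have := hne h
        exact_mod_cast (by omega : 0 ≤ g.vec 1 - g'.vec 1)
      nlinarith
    · have h' : (0 : ℝ) ≤ g.vec 0 - g'.vec 0 := by
        exact_mod_cast (by omega : 0 ≤ g.vec 0 - g'.vec 0)
      nlinarith
  obtain ⟨m0, m1⟩ := hm
  have hfin : g.vec 2 - g'.vec 2 = (f.vec 0 - f'.vec 0)
      + a (n + 1) * (g.vec 0 - g'.vec 0) + b (n + 1) * (g.vec 1 - g'.vec 1) - k + k' := by
    rw [e2, e2', e0, e0', e1, e1']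
    ring
  rw [m0, m1] at hfin
  omega

theorem close_parent (hV : IsOrbit a b V) (hab : Admissible a b) {n : ℕ} {f f' g g' : Face}
    (hfg : Close f.vec f'.vec)
    (hg : g ∈ discretePlane (V (n + 1))) (hp : IsParent (a (n + 1)) (b (n + 1)) f g)
    (hg' : g' ∈ discretePlane (V (n + 1))) (hp' : IsParent (a (n + 1)) (b (n + 1)) f' g') :
    Close g.vec g'.vec := by
  have h1 := hV.parent_sub_le hab hfg hg hp hg' hp'
  have h2 := hV.parent_sub_le hab hfg.symm hg' hp' hg hp
  obtain ⟨k, e0, e1, e2, hk⟩ := hp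
  obtain ⟨k', e0', e1', e2', hk'⟩ := hp'
  intro i
  have hi : i = 0 ∨ i = 1 ∨ i = 2 := by omega
  rcases hi with rfl | rfl | rfl
  · rw [e0, e0']
    exact hfg 1
  · rw [e1, e1']
    exact hfg 2
  · rw [abs_le]
    constructor <;> linarith

theorem close_lineage (hV : IsOrbit a b V) (hab : Admissible a b) {c d : ℕ → Face}
    (hc : IsLineage a b V c) (hd : IsLineage a b V d) (h : Close (c 0).vec (d 0).vec) (n : ℕ) :
    Close (c n).vec (d n).vec := by
  induction n with
  | zero => exact h
  | succ n ih =>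
    exact hV.close_parent hab ih (hc.mem _) (hc.parent n) (hd.mem _) (hd.parent n)

end IsOrbit

/-! ### Faces close to the half cube -/

/-- The vectors close to `0` in a discrete plane. -/
theorem cases_of_close_zero {v : Fin 3 → ℝ} (hpos : ∀ i, 0 < v i) (h02 : v 0 < v 2)
    (h12 : v 1 < v 2) {f : Face} (hf : f ∈ discretePlane v) (hc : Close f.vec 0)
    (h0 : f.vec ≠ 0) :
    f.vec 2 = 0 ∧ (f.vec 0 = 1 ∧ -1 ≤ f.vec 1 ∨ f.vec 1 = 1) ∨
    f.vec 2 = 1 ∧ (f.vec 0 = -1 ∨ f.vec 0 = 0 ∧ f.vec 1 = -1 ∨ f.vec 0 = 1 ∧ f.vec 1 = -1) ∨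
    f.vec 2 = -1 ∧ f.vec 0 = 1 ∧ f.vec 1 = 1 := by
  rw [mem_discretePlane] at hf
  have hle : v f.type ≤ v 2 := by
    have hj : f.type = 0 ∨ f.type = 1 ∨ f.type = 2 := by omega
    rcases hj with hj | hj | hj <;> rw [hj]
    · exact h02.le
    · exact h12.le
  obtain ⟨h1, h2⟩ := hf
  have h2 := h2.trans_le hle
  have c : ∀ i, f.vec i = -1 ∨ f.vec i = 0 ∨ f.vec i = 1 := by
    intro i
    have := abs_le.1 (hc i)
    simp only [Pi.zero_apply] at this
    omega
  have h0' : ¬(f.vec 0 = 0 ∧ f.vec 1 = 0 ∧ f.vec 2 = 0) := by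
    rintro ⟨e0, e1, e2⟩
    apply h0
    ext i
    have hi : i = 0 ∨ i = 1 ∨ i = 2 := by omega
    rcases hi with rfl | rfl | rfl <;> assumption
  have p0 := hpos 0
  have p1 := hpos 1
  have p2 := hpos 2
  rcases c 0 with e0 | e0 | e0 <;> rcases c 1 with e1 | e1 | e1 <;>
    rcases c 2 with e2 | e2 | e2 <;> rw [e0, e1, e2] at h1 h2 <;> push_cast at h1 h2 <;>
    first
    | (exfalso; linarith)
    | (rw [e0, e1, e2] at h0' ⊢; omega)

end JacobiPerron
namespace JacobiPerron

/-- The condition on the digits under which the patterns do not cover the discrete plane. -/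
def HasExceptionalTail (a b : ℕ → ℕ) : Prop :=
  ∃ ℓ ≥ 1, ∀ k, a (ℓ + 3 * k) = 0 ∧ a (ℓ + 3 * k + 1) = b (ℓ + 3 * k + 1) ∧
    0 < a (ℓ + 3 * k + 2) ∧ a (ℓ + 3 * k + 2) < b (ℓ + 3 * k + 2)

namespace IsOrbit

variable {a b : ℕ → ℕ} {V : ℕ → Fin 3 → ℝ}

/-- A lineage that stays close to the half cube without entering it is eventually periodic. -/
theorem eventually_cycle (hV : IsOrbit a b V) (hab : Admissible a b) {c : ℕ → Face}
    (hc : IsLineage a b V c) {N : ℕ} (hclose : ∀ n ≥ N, Close (c n).vec 0)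
    (hne : ∀ n ≥ N, (c n).vec ≠ 0) :
    ∃ m ≥ N, ∀ k, ((c (m + 3 * k)).vec 0 = -1 ∧ (c (m + 3 * k)).vec 1 = 1 ∧
      (c (m + 3 * k)).vec 2 = 1) ∧ (c (m + 3 * k + 1)).vec 2 = -1 ∧
      (c (m + 3 * k + 2)).vec 2 = 1 := by
  have hcase := fun n (hn : n ≥ N) => cases_of_close_zero (hV.pos n) (hV.zero_lt_two hab n)
    (hV.one_lt_two hab n) (hc.mem n) (hclose n hn) (hne n hn)
  have hs0 : ∀ n, (c (n + 1)).vec 0 = (c n).vec 1 := fun n => by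
    obtain ⟨k, h, -⟩ := hc.parent n
    exact h
  have hs1 : ∀ n, (c (n + 1)).vec 1 = (c n).vec 2 := fun n => by
    obtain ⟨k, -, h, -⟩ := hc.parent n
    exact h
  have hbd : ∀ n ≥ N, ∀ i, -1 ≤ (c n).vec i ∧ (c n).vec i ≤ 1 := fun n hn i => by
    have := abs_le.1 (hclose n hn i)
    simpa using this
  have hr : ∀ n ≥ N, (c n).vec 2 ≠ 0 := by
    intro n hn h0
    have t1 := hcase (n + 1) (by omega)
    have t2 := hcase (n + 2) (by omega)
    have t3 := hcase (n + 3) (by omega)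
    have t4 := hcase (n + 4) (by omega)
    simp only [hs0, hs1] at t1 t2 t3 t4
    have b0 := hbd (n + 1) (by omega) 2
    have u1 : (c n).vec 1 = 1 ∧ (c (n + 1)).vec 2 = 0 ∨
      (c n).vec 1 = -1 ∧ (c (n + 1)).vec 2 = 1 := by omega
    rcases u1 with ⟨u, u'⟩ | ⟨u, u'⟩ <;> omega
  have hstep : ∀ n ≥ N, (c n).vec 0 = -1 ∧ (c n).vec 1 = 1 ∧ (c n).vec 2 = 1 →
      (c (n + 1)).vec 2 = -1 ∧ (c (n + 2)).vec 2 = 1 ∧ (c (n + 3)).vec 2 = 1 := by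
    rintro n hn ⟨h0, h1, h2⟩
    have t1 := hcase (n + 1) (by omega)
    have t2 := hcase (n + 2) (by omega)
    have t3 := hcase (n + 3) (by omega)
    have r1 := hr (n + 1) (by omega)
    have r2 := hr (n + 2) (by omega)
    have r3 := hr (n + 3) (by omega)
    simp only [hs0, hs1] at t1 t2 t3
    have u1 : (c (n + 1)).vec 2 = -1 := by omega
    have u2 : (c (n + 2)).vec 2 = 1 := by omega
    have u3 : (c (n + 3)).vec 2 = 1 := by omega
    exact ⟨u1, u2, u3⟩
  obtain ⟨m, hm, hA⟩ : ∃ m ≥ N, (c m).vec 0 = -1 ∧ (c m).vec 1 = 1 ∧ (c m).vec 2 = 1 := by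
    have r0 := hr N le_rfl
    have r1 := hr (N + 1) (by omega)
    have r2 := hr (N + 2) (by omega)
    have r3 := hr (N + 3) (by omega)
    have r4 := hr (N + 4) (by omega)
    have t2 := hcase (N + 2) (by omega)
    have t3 := hcase (N + 3) (by omega)
    have t4 := hcase (N + 4) (by omega)
    have b0 := hbd N (by omega) 2
    have b1 := hbd (N + 1) (by omega) 2
    simp only [hs0, hs1] at t2 t3 t4
    by_contra! h
    have g2 := h (N + 2) (by omega)
    have g3 := h (N + 3) (by omega)
    have g4 := h (N + 4) (by omega)
    simp only [hs0, hs1] at g2 g3 g4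
    rcases t2 with t2 | t2 | t2 <;> omega
  refine ⟨m, hm, fun k => ?_⟩
  have hcyc : (c (m + 3 * k)).vec 0 = -1 ∧ (c (m + 3 * k)).vec 1 = 1 ∧
      (c (m + 3 * k)).vec 2 = 1 := by
    induction k with
    | zero => exact hA
    | succ k ih =>
      obtain ⟨h1, h2, h3⟩ := hstep (m + 3 * k) (by omega) ih
      rw [show m + 3 * (k + 1) = m + 3 * k + 2 + 1 from by ring]
      refine ⟨?_, ?_, h3⟩
      · rw [hs0, hs1]
        exact h1
      · rw [hs1]
        exact h2
  obtain ⟨h1, h2, -⟩ := hstep (m + 3 * k) (by omega) hcyc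
  exact ⟨hcyc, h1, h2⟩

theorem hasExceptionalTail_of_close (hV : IsOrbit a b V) (hab : Admissible a b) {c : ℕ → Face}
    (hc : IsLineage a b V c) {N : ℕ} (hclose : ∀ n ≥ N, Close (c n).vec 0)
    (hne : ∀ n ≥ N, (c n).vec ≠ 0) : HasExceptionalTail a b := by
  obtain ⟨m, -, hm⟩ := hV.eventually_cycle hab hc hclose hne
  have hfirst : ∀ k, a (m + 3 * k + 1) = 0 ∧ (c (m + 3 * k)).type = 2 := by
    intro k
    obtain ⟨⟨h0, h1, h2⟩, h3, -⟩ := hm k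
    obtain ⟨d, -, -, e, ht⟩ := hc.parent (m + 3 * k)
    rw [h0, h1, h2, h3] at e
    obtain ⟨hle, hb, -⟩ := hab (m + 3 * k + 1) (by omega)
    omega
  refine ⟨m + 1, by omega, fun k => ?_⟩
  rw [show m + 1 + 3 * k = m + 3 * k + 1 from by ring]
  obtain ⟨⟨h0, h1, h2⟩, h3, h4⟩ := hm k
  obtain ⟨⟨h5, h6, h7⟩, -⟩ := hm (k + 1)
  have hnext := hfirst (k + 1)
  rw [show m + 3 * (k + 1) = m + 3 * k + 2 + 1 from by ring] at h5 h6 h7 hnext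
  obtain ⟨d, e0, e1, e2, ht⟩ := hc.parent (m + 3 * k)
  obtain ⟨d', e0', e1', e2', ht'⟩ := hc.parent (m + 3 * k + 1)
  obtain ⟨d'', e0'', e1'', e2'', ht''⟩ := hc.parent (m + 3 * k + 2)
  rw [h1] at e0
  rw [h2] at e1
  rw [e1] at e0'
  rw [h3] at e1'
  rw [e0, e1, h3, show m + 3 * k + 1 + 1 = m + 3 * k + 2 from rfl, h4] at e2'
  rw [show m + 3 * k + 1 + 1 = m + 3 * k + 2 from rfl] at e0' e1'
  rw [e0', e1', h4, h7] at e2''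
  obtain ⟨hle', hb', -⟩ := hab (m + 3 * k + 2) (by omega)
  obtain ⟨hle'', hb'', hne''⟩ := hab (m + 3 * k + 2 + 1) (by omega)
  have hlt : a (m + 3 * k + 2 + 1) ≠ b (m + 3 * k + 2 + 1) := fun h => hne'' h hnext.1
  refine ⟨(hfirst k).1, ?_, ?_, ?_⟩
  · show a (m + 3 * k + 2) = b (m + 3 * k + 2)
    omega
  · show 0 < a (m + 3 * k + 2 + 1)
    omega
  · exact lt_of_le_of_ne hle'' hlt

/-- Without exceptional tail, every lineage enters the half cube. -/
theorem exists_vec_eq_zero (hV : IsOrbit a b V) (hab : Admissible a b)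
    (htail : ¬HasExceptionalTail a b) {c : ℕ → Face} (hc : IsLineage a b V c) :
    ∃ n, (c n).vec = 0 := by
  induction hs : ∑ i, ((c 0).vec i).natAbs using Nat.strong_induction_on generalizing c with
  | _ s ih =>
    by_cases h0 : (c 0).vec = 0
    · exact ⟨0, h0⟩
    obtain ⟨g, hg, hclose, hlt⟩ :=
      exists_close_smaller (hV.pos 0) (hV.le_two hab 0) (hc.mem 0) h0
    obtain ⟨d, hd, rfl⟩ := hV.exists_lineage hg
    obtain ⟨N, hN⟩ := ih _ (hs ▸ hlt) hd rfl
    by_contra! hne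
    refine htail (hV.hasExceptionalTail_of_close hab hc (N := N) (fun n hn => ?_)
      fun n _ => hne n)
    rw [← hV.vec_eq_zero_of_le hab hd hn hN]
    exact hV.close_lineage hab hc hd hclose n

/-- With an exceptional tail, some lineage never enters the half cube. -/
theorem exists_lineage_ne_zero (hV : IsOrbit a b V) (hab : Admissible a b)
    (htail : HasExceptionalTail a b) :
    ∃ c, IsLineage a b V c ∧ ∀ n, (c n).vec ≠ 0 := by
  obtain ⟨ℓ, hℓ, htail⟩ := htail
  obtain ⟨m, rfl⟩ : ∃ m, ℓ = m + 1 := ⟨ℓ - 1, by omega⟩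
  have hA : ∀ k, (⟨![-1, 1, 1], 2⟩ : Face) ∈ discretePlane (V (m + 3 * k)) := by
    intro k
    rw [mem_discretePlane]
    have h1 := hV.eq_one (m + 3 * k)
    rw [show m + 3 * k + 1 = m + 1 + 3 * k from by ring, (htail k).1,
      show m + 1 + 3 * k = m + 3 * k + 1 from by ring] at h1
    have h2 := hV.eq_zero (m + 3 * k)
    have h3 := hV.zero_lt_two hab (m + 3 * k + 1)
    have h4 := hV.zero_lt_two hab (m + 3 * k)
    have h5 := hV.pos (m + 3 * k) 1
    simp only [Matrix.cons_val_zero, Matrix.cons_val_one, Matrix.cons_val]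
    push_cast at h1 ⊢
    constructor <;> linarith
  have hF : ∀ k, (⟨![1, 1, -1], 1⟩ : Face) ∈ discretePlane (V (m + 3 * k + 1)) := by
    intro k
    rw [mem_discretePlane]
    have h1 := hV.eq_one (m + 3 * k + 1)
    have h2 := hV.eq_two (m + 3 * k + 1)
    rw [show m + 3 * k + 1 + 1 = m + 1 + 3 * k + 1 from by ring, (htail k).2.1] at h1
    rw [show m + 3 * k + 1 + 1 = m + 1 + 3 * k + 1 from by ring] at h2
    have h3 := hV.eq_zero (m + 3 * k + 1)
    rw [show m + 3 * k + 1 + 1 = m + 1 + 3 * k + 1 from by ring] at h3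
    have h4 := hV.one_lt_two hab (m + 1 + 3 * k + 1)
    have h5 := hV.zero_lt_two hab (m + 3 * k + 1)
    have h6 := hV.pos (m + 1 + 3 * k + 1) 0
    simp only [Matrix.cons_val_zero, Matrix.cons_val_one, Matrix.cons_val]
    push_cast
    constructor <;> linarith
  have hB : ∀ k, (⟨![1, -1, 1], 2⟩ : Face) ∈ discretePlane (V (m + 3 * k + 2)) := by
    intro k
    rw [mem_discretePlane]
    have h1 := hV.eq_one (m + 3 * k + 2)
    have h3 := hV.eq_zero (m + 3 * k + 2)
    rw [show m + 3 * k + 2 + 1 = m + 1 + 3 * k + 2 from by ring] at h1 h3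
    have h2 : (1 : ℝ) ≤ a (m + 1 + 3 * k + 2) := by exact_mod_cast (htail k).2.2.1
    have h4 := hV.one_lt_two hab (m + 3 * k + 2)
    have h5 := hV.pos (m + 3 * k + 2) 0
    have h6 := hV.pos (m + 1 + 3 * k + 2) 0
    have h7 := hV.pos (m + 1 + 3 * k + 2) 2
    have h8 : V (m + 3 * k + 2) 0 < V (m + 3 * k + 2) 1 := by nlinarith
    simp only [Matrix.cons_val_zero, Matrix.cons_val_one, Matrix.cons_val]
    push_cast
    constructor <;> linarith
  have hA' : {(⟨![-1, 1, 1], 2⟩ : Face)} ⊆ discretePlane (V m) :=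
    Set.singleton_subset_iff.2 (hA 0)
  obtain ⟨f, hf⟩ := dualProduct_nonempty a b m
    (Set.singleton_nonempty (⟨![-1, 1, 1], 2⟩ : Face))
  obtain ⟨c, hc, rfl⟩ := hV.exists_lineage (hV.dualProduct_subset m hA' hf)
  have hcm : c m = ⟨![-1, 1, 1], 2⟩ := (hV.mem_dualProduct_iff hc m hA').1 hf
  have hcyc : ∀ k, c (m + 3 * k) = ⟨![-1, 1, 1], 2⟩ := by
    intro k
    induction k with
    | zero => exact hcm
    | succ k ih =>
      obtain ⟨t1, t2, t3, t4⟩ := htail k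
      rw [show m + 1 + 3 * k = m + 3 * k + 1 from by ring] at t1 t2 t3 t4
      have c1 : c (m + 3 * k + 1) = ⟨![1, 1, -1], 1⟩ := by
        refine hV.parent_unique (hc.mem _) (hc.parent (m + 3 * k)) (hF k) ?_
        rw [ih]
        exact ⟨b (m + 3 * k + 1), by simp [t1]⟩
      have c2 : c (m + 3 * k + 2) = ⟨![1, -1, 1], 2⟩ := by
        refine hV.parent_unique (hc.mem _) (hc.parent (m + 3 * k + 1)) (hB k) ?_
        rw [c1, t2]
        have hb := (hab (m + 3 * k + 1 + 1) (by omega)).2.1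
        exact ⟨0, by simp [Nat.pos_of_ne_zero hb]⟩
      refine hV.parent_unique (n := m + 3 * k + 2) (hc.mem _) (hc.parent (m + 3 * k + 2))
        (hA (k + 1)) ?_
      rw [c2]
      refine ⟨b (m + 3 * k + 1 + 2) - a (m + 3 * k + 1 + 2), rfl, rfl, ?_,
        Or.inr (Or.inr ⟨rfl, Or.inl ⟨rfl, ?_⟩⟩)⟩
      · simp only [Matrix.cons_val_zero, Matrix.cons_val_one, Matrix.cons_val]
        rw [Nat.cast_sub t4.le]
        show (1 : ℤ) = 1 + a (m + 3 * k + 1 + 2) * (-1) + b (m + 3 * k + 1 + 2) * 1 - _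
        ring
      · show _ < b (m + 3 * k + 1 + 2)
        omega
  refine ⟨c, hc, fun n hn => ?_⟩
  have h := hV.vec_eq_zero_of_le hab hc (by omega : n ≤ m + 3 * n) hn
  rw [hcyc] at h
  simpa using congrFun h 1

theorem iUnion_pattern_ssubset_iff (hV : IsOrbit a b V) (hab : Admissible a b) :
    ⋃ n, pattern a b n ⊂ discretePlane (V 0) ↔ HasExceptionalTail a b := by
  have hsub : ⋃ n, pattern a b n ⊆ discretePlane (V 0) :=
    Set.iUnion_subset fun n => hV.dualProduct_subset n (hV.halfCube_subset n)
  constructor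
  · intro h
    by_contra htail
    refine h.2 fun f hf => ?_
    obtain ⟨c, hc, rfl⟩ := hV.exists_lineage hf
    obtain ⟨n, hn⟩ := hV.exists_vec_eq_zero hab htail hc
    exact Set.mem_iUnion.2 ⟨n, (hV.mem_pattern_iff hc n).2 hn⟩
  · intro htail
    obtain ⟨c, hc, hne⟩ := hV.exists_lineage_ne_zero hab htail
    refine ⟨hsub, fun h => ?_⟩
    obtain ⟨n, hn⟩ := Set.mem_iUnion.1 (h (hc.mem 0))
    exact hne n ((hV.mem_pattern_iff hc n).1 hn)

end IsOrbit
end JacobiPerron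

open JacobiPerron in
theorem theorem4p3 (a b : ℕ → ℕ) (hab : Admissible a b) :
    (∃ v : Fin 3 → ℝ, (∀ i, 0 < v i) ∧ IsExpansion v a b) ∧
    ∀ v : Fin 3 → ℝ, (∀ i, 0 < v i) → IsExpansion v a b →
      (∀ n, (pattern a b n).Finite) ∧
      StrictMono (fun n => region (pattern a b n)) ∧
      (∀ n, region (pattern a b n) ⊆ region (discretePlane v)) ∧
      ((⋃ n, region (pattern a b n)) ⊂ region (discretePlane v) ↔
        ∃ ℓ ≥ 1, ∀ k, a (ℓ + 3 * k) = 0 ∧ a (ℓ + 3 * k + 1) = b (ℓ + 3 * k + 1) ∧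
          0 < a (ℓ + 3 * k + 2) ∧ a (ℓ + 3 * k + 2) < b (ℓ + 3 * k + 2)) := by
  constructor
  · obtain ⟨V, hV⟩ := exists_isOrbit hab
    exact ⟨V 0, hV.pos 0, hV.isExpansion hab⟩
  · intro v hpos hv
    have hV := hv.isOrbit hpos hab
    refine ⟨fun n => finite_dualProduct a b n finite_halfCube, fun m n hmn => ?_, fun n => ?_, ?_⟩
    · exact region_ssubset_region.2 (hV.pattern_strictMono hab hmn)
    · exact region_subset_region.2 (hV.dualProduct_subset n (hV.halfCube_subset n))
    · rw [iUnion_region, region_ssubset_region]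
      exact hV.iUnion_pattern_ssubset_iff hab
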